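/- Let $d\in\mathbb N$. A mask is a finitely supported sequence $a:\mathbb Z^d\to\mathbb R$; its symbol is $a(z)=\sum_{\alpha\in\mathbb Z^d}a(\alpha)z^\alpha$, where $z^\alpha=z_1^{\alpha_1}\cdots z_d^{\alpha_d}$ and $z\in(\mathbb C\setminus\{0\})^d$, and its subdivision operator is $(S_af)(\alpha)=\sum_{\beta\in\mathbb Z^d}a(\alpha-2\beta)f(\beta)$. For $s\in\mathbb N_0\cup\{\infty\}$, a scheme $(S_{c_\ell}:\ell\in\mathbb N_0)$ given by masks $c_\ell$ is said to converge to $C^s$ limits if for every bounded $f:\mathbb Z^d\to\mathbb R$ there is $g\in C^s(\mathbb R^d)$ with $$\lim_{\ell\to\infty}\ \sup_{\alpha\in\mathbb Z^d}\bigl|g(2^{-(\ell+1)}\alpha)-(S_{c_\ell}S_{c_{\ell-1}}\cdots S_{c_0}f)(\alpha)\bigr|=0,$$ and $g\neq 0$ for at least one nonzero bounded $f$. A single operator $S_a$ is called convergent if the scheme with $c_\ell=a$ for all $\ell$ converges to $C^0$ limits. Let $D_0$ be a finite collection of vectors in $\mathbb N_0^d$, possibly with repetitions, that contains a basis of $\mathbb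 R^d$. Let $a$ be the mask with symbol $$a(z)=2^d\prod_{v\in D_0}\frac{1+z^v}{2},$$ and assume that $S_a$ is convergent. Let $r\ge 1$ be an integer and let $c_\ell$, $\ell\in\mathbb N_0$, be the masks with symbols $$c_{kr+j}(z)=2^{-dk}\,a(z)^{k+1},\qquad k\in\mathbb N_0,\quad j=0,\dots,r-1.$$ Then the non-stationary scheme $(S_{c_\ell}:\ell\in\mathbb N_0)$ converges to $C^\infty$ limits. -/

import Mathlib

namespace Subdivision

/-- Real sequences indexed by `ℤ^d`. -/
abbrev Seq (d : ℕ) : Type := (Fin d → ℤ) → ℝ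

/-- A subdivision mask: a finitely supported real sequence on `ℤ^d`. -/
abbrev Mask (d : ℕ) : Type := (Fin d → ℤ) →₀ ℝ

/-- The subdivision operator `(S_a f)(α) = ∑_{β ∈ ℤ^d} a(α - 2β) f(β)`.
Only finitely many summands are nonzero, since `a` has finite support. -/
noncomputable def subdivOp {d : ℕ} (a : Mask d) (f : Seq d) : Seq d :=
  fun α => ∑ᶠ β : Fin d → ℤ, a (α - 2 • β) * f β

/-- The data `f^{[n]} = S_{c_{n-1}} ⋯ S_{c_0} f^{[0]}` generated by the scheme
`(S_{c_k} : k ∈ ℕ)` from the initial sequence `f^{[0]}`. -/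
noncomputable def refinedData {d : ℕ} (c : ℕ → Mask d) (f₀ : Seq d) : ℕ → Seq d
  | 0 => f₀
  | n + 1 => subdivOp (c n) (refinedData c f₀ n)

/-- `g` is the limit of the scheme from the initial sequence `f₀`:
`‖g(2^{-(k+1)} ·) - S_{c_k} ⋯ S_{c_0} f₀‖_∞ → 0` as `k → ∞`, the supremum norm being taken over
`ℤ^d`. -/
def IsLimitFunction {d : ℕ} (c : ℕ → Mask d) (f₀ : Seq d) (g : (Fin d → ℝ) → ℝ) : Prop :=
  TendstoUniformly
    (fun (k : ℕ) (α : Fin d → ℤ) =>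
      g (fun i => (2 : ℝ) ^ (-((k : ℤ) + 1)) * (α i : ℝ)) - refinedData c f₀ (k + 1) α)
    (fun _ => 0) Filter.atTop

/-- The scheme `(S_{c_k} : k ∈ ℕ)` converges to `C^s(ℝ^d)` limit functions (`s = ⊤` is `C^∞`):
every bounded initial sequence has a limit function of class `C^s`, and this limit is not the zero
function for at least one nonzero bounded initial sequence. -/
def ConvergesToCs {d : ℕ} (s : ℕ∞) (c : ℕ → Mask d) : Prop :=
  (∀ f₀ : Seq d, Memℓp f₀ ⊤ →
    ∃ g : (Fin d → ℝ) → ℝ, ContDiff ℝ s g ∧ IsLimitFunction c f₀ g) ∧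
  ∃ f₀ : Seq d, f₀ ≠ 0 ∧ Memℓp f₀ ⊤ ∧
    ∃ g : (Fin d → ℝ) → ℝ, g ≠ 0 ∧ ContDiff ℝ s g ∧ IsLimitFunction c f₀ g

/-- The stationary scheme `S_a` (the same mask at every level) is convergent, that is, it converges
to continuous limit functions. -/
def StationaryConvergent {d : ℕ} (a : Mask d) : Prop :=
  ConvergesToCs 0 (fun _ : ℕ => a)

/-- The symbol `a(z) = ∑_α a(α) z^α`, `z^α = z_1^{α_1} ⋯ z_d^{α_d}`, of a mask; it is used
for `z ∈ (ℂ \ {0})^d` only. -/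
noncomputable def symbol {d : ℕ} (a : Mask d) (z : Fin d → ℂ) : ℂ :=
  ∑ α ∈ a.support, (a α : ℂ) * ∏ i, z i ^ α i

/-- `s_D(z) = ∏_{v ∈ D} (1 + z^v) / 2` for a finite collection `D` of directions in `ℕ^d`,
in which directions may be repeated. -/
noncomputable def smoothingSymbol {d : ℕ} (D : Multiset (Fin d → ℕ)) (z : Fin d → ℂ) : ℂ :=
  (D.map fun v => (1 + ∏ i, z i ^ v i) / 2).prod

end Subdivision

open Filter Topology

namespace Subdivision

variable {d : ℕ}

/-- The backward translation `f ↦ f(· - v)` of sequences. -/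
def shift (v : Fin d → ℤ) (f : Seq d) : Seq d := fun α => f (α - v)

/-- The averaging operator of the symbol `(1 + z^v) / 2`. -/
noncomputable def avg (v : Fin d → ℤ) (f : Seq d) : Seq d := fun α => (f α + f (α - v)) / 2

/-- The backward difference in direction `v`. -/
def diff (v : Fin d → ℤ) (f : Seq d) : Seq d := fun α => f α - f (α - v)

theorem avg_comm (v w : Fin d → ℤ) (f : Seq d) : avg v (avg w f) = avg w (avg v f) := by
  funext α
  simp only [avg, sub_right_comm α v w]
  ring

theorem diff_avg_comm (v w : Fin d → ℤ) (f : Seq d) : diff v (avg w f) = avg w (diff v f) := by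
  funext α
  simp only [avg, diff, sub_right_comm α v w]
  ring

theorem diff_avg_self (v : Fin d → ℤ) (f : Seq d) :
    diff v (avg v f) = (1 / 2 : ℝ) • diff (2 • v) f := by
  funext α
  simp only [avg, diff, Pi.smul_apply, smul_eq_mul, two_smul, sub_sub]
  ring

theorem diff_smul (v : Fin d → ℤ) (t : ℝ) (f : Seq d) : diff v (t • f) = t • diff v f := by
  funext α
  simp only [diff, Pi.smul_apply, smul_eq_mul]
  ring

theorem avg_smul (v : Fin d → ℤ) (t : ℝ) (f : Seq d) : avg v (t • f) = t • avg v f := by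
  funext α
  simp only [avg, Pi.smul_apply, smul_eq_mul]
  ring

instance : LeftCommutative (avg (d := d)) := ⟨avg_comm⟩

/-- The composition of the averaging operators in all directions of `E`. -/
noncomputable def avgs (E : Multiset (Fin d → ℤ)) (f : Seq d) : Seq d := E.foldr avg f

@[simp] theorem avgs_zero (f : Seq d) : avgs 0 f = f := rfl

@[simp] theorem avgs_cons (v : Fin d → ℤ) (E : Multiset (Fin d → ℤ)) (f : Seq d) :
    avgs (v ::ₘ E) f = avg v (avgs E f) := Multiset.foldr_cons _ _ _ _

theorem avgs_add (E F : Multiset (Fin d → ℤ)) (f : Seq d) :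
    avgs (E + F) f = avgs E (avgs F f) := by
  induction E using Multiset.induction_on with
  | empty => simp
  | cons v E ih => rw [Multiset.cons_add, avgs_cons, avgs_cons, ih]

theorem avgs_smul (E : Multiset (Fin d → ℤ)) (t : ℝ) (f : Seq d) :
    avgs E (t • f) = t • avgs E f := by
  induction E using Multiset.induction_on with
  | empty => simp
  | cons v E ih => rw [avgs_cons, avgs_cons, ih, avg_smul]

theorem diff_avgs_comm (v : Fin d → ℤ) (E : Multiset (Fin d → ℤ)) (f : Seq d) :
    diff v (avgs E f) = avgs E (diff v f) := by
  induction E using Multiset.induction_on with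
  | empty => simp
  | cons w E ih => rw [avgs_cons, avgs_cons, diff_avg_comm, ih]

theorem two_smul_inj : Function.Injective fun β : Fin d → ℤ => 2 • β := by
  intro β γ h
  funext i
  have := congrFun h i
  simpa using this

theorem sub_two_smul_inj (α : Fin d → ℤ) : Function.Injective fun β : Fin d → ℤ => α - 2 • β :=
  fun _ _ h => two_smul_inj (sub_right_injective h)

/-- The indices that contribute to `(S_a f)(α)`. -/
noncomputable def stencil (a : Mask d) (α : Fin d → ℤ) : Finset (Fin d → ℤ) :=
  a.support.preimage (fun β => α - 2 • β) (sub_two_smul_inj α).injOn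

theorem mem_stencil {a : Mask d} {α β : Fin d → ℤ} : β ∈ stencil a α ↔ a (α - 2 • β) ≠ 0 := by
  simp [stencil]

theorem subdivOp_eq_sum (a : Mask d) (f : Seq d) (α : Fin d → ℤ) :
    subdivOp a f α = ∑ β ∈ stencil a α, a (α - 2 • β) * f β := by
  refine finsum_eq_sum_of_support_subset _ fun β hβ => ?_
  exact mem_stencil.2 (left_ne_zero_of_mul hβ)

/-- The subdivision operator as a linear map. -/
noncomputable def subdivLin (a : Mask d) : Module.End ℝ (Seq d) where
  toFun := subdivOp a
  map_add' f g := by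
    funext α
    simp only [Pi.add_apply, subdivOp_eq_sum, mul_add, Finset.sum_add_distrib]
  map_smul' t f := by
    funext α
    simp only [Pi.smul_apply, subdivOp_eq_sum, smul_eq_mul, Finset.mul_sum, RingHom.id_apply]
    exact Finset.sum_congr rfl fun _ _ => by ring

@[simp] theorem subdivLin_apply (a : Mask d) (f : Seq d) : subdivLin a f = subdivOp a f := rfl

theorem subdivOp_add (a : Mask d) (f g : Seq d) :
    subdivOp a (f + g) = subdivOp a f + subdivOp a g := (subdivLin a).map_add f g

theorem subdivOp_sub (a : Mask d) (f g : Seq d) :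
    subdivOp a (f - g) = subdivOp a f - subdivOp a g := (subdivLin a).map_sub f g

theorem subdivOp_smul (a : Mask d) (t : ℝ) (f : Seq d) :
    subdivOp a (t • f) = t • subdivOp a f := (subdivLin a).map_smul t f

theorem subdivOp_shift (a : Mask d) (v : Fin d → ℤ) (f : Seq d) :
    subdivOp a (shift v f) = shift (2 • v) (subdivOp a f) := by
  funext α
  simp only [subdivOp, shift]
  rw [← finsum_comp_equiv (Equiv.addRight v)]
  refine finsum_congr fun β => ?_
  simp only [Equiv.coe_addRight, add_sub_cancel_right, smul_add]
  congr 2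
  abel

theorem avg_eq (v : Fin d → ℤ) (f : Seq d) : avg v f = (1 / 2 : ℝ) • (f + shift v f) := by
  funext α
  simp only [avg, shift, Pi.smul_apply, Pi.add_apply, smul_eq_mul]
  ring

theorem diff_eq (v : Fin d → ℤ) (f : Seq d) : diff v f = f - shift v f := rfl

theorem subdivOp_avg (a : Mask d) (v : Fin d → ℤ) (f : Seq d) :
    subdivOp a (avg v f) = avg (2 • v) (subdivOp a f) := by
  rw [avg_eq, avg_eq, subdivOp_smul, subdivOp_add, subdivOp_shift]

theorem subdivOp_diff (a : Mask d) (v : Fin d → ℤ) (f : Seq d) :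
    subdivOp a (diff v f) = diff (2 • v) (subdivOp a f) := by
  rw [diff_eq, diff_eq, subdivOp_sub, subdivOp_shift]

theorem subdivOp_avgs (a : Mask d) (E : Multiset (Fin d → ℤ)) (f : Seq d) :
    subdivOp a (avgs E f) = avgs (E.map (2 • ·)) (subdivOp a f) := by
  induction E using Multiset.induction_on with
  | empty => simp
  | cons v E ih => rw [avgs_cons, Multiset.map_cons, avgs_cons, subdivOp_avg, ih]

/-- Iterated backward differences. -/
def diffs (w : List (Fin d → ℤ)) (f : Seq d) : Seq d := w.foldr diff f

@[simp] theorem diffs_cons (v : Fin d → ℤ) (w : List (Fin d → ℤ)) (f : Seq d) :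
    diffs (v :: w) f = diff v (diffs w f) := rfl

/-- Each difference in a direction `v` absorbs one smoothing factor of direction `v` and gains
a factor `1 / 2`. -/
theorem diffs_avgs_subdivOp (a : Mask d) (w : List (Fin d → ℤ)) (E : Multiset (Fin d → ℤ))
    (f : Seq d) :
    diffs w (avgs (E + w) (subdivOp a f)) =
      (1 / 2 : ℝ) ^ w.length • avgs E (subdivOp a (diffs w f)) := by
  induction w generalizing E with
  | nil => simp [diffs]
  | cons v w ih =>
    have h : E + ((v :: w : List (Fin d → ℤ)) : Multiset (Fin d → ℤ)) = (v ::ₘ E) + w := by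
      rw [← Multiset.cons_coe, Multiset.add_cons, Multiset.cons_add]
    rw [diffs_cons, h, ih, diff_smul, avgs_cons, diff_avg_self, diff_avgs_comm,
      ← subdivOp_diff, smul_smul, diffs_cons, List.length_cons, pow_succ]

/-- The mask with symbol `a(z) (1 + z^v) / 2`. -/
noncomputable def avgMask (v : Fin d → ℤ) (a : Mask d) : Mask d :=
  (1 / 2 : ℝ) • (a + a.mapDomain (· + v))

theorem avgMask_apply (v : Fin d → ℤ) (a : Mask d) (α : Fin d → ℤ) :
    avgMask v a α = (a α + a (α - v)) / 2 := by
  have h : a.mapDomain (· + v) α = a (α - v) := by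
    have := Finsupp.mapDomain_apply (add_left_injective v) a (α - v)
    simpa using this
  simp only [avgMask, Finsupp.smul_apply, Finsupp.add_apply, h, smul_eq_mul]
  ring

theorem subdivOp_avgMask (v : Fin d → ℤ) (a : Mask d) (f : Seq d) :
    subdivOp (avgMask v a) f = avg v (subdivOp a f) := by
  funext α
  have h : ∀ α, (Function.support fun β : Fin d → ℤ => a (α - 2 • β) * f β).Finite := fun α =>
    (stencil a α).finite_toSet.subset fun β hβ => mem_stencil.2 (left_ne_zero_of_mul hβ)
  simp only [avg, subdivOp]
  rw [← finsum_add_distrib (h α) (h (α - v)), div_eq_inv_mul, mul_finsum]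
  · refine finsum_congr fun β => ?_
    rw [avgMask_apply, sub_right_comm α v]
    ring

theorem symbol_eq_sum (a : Mask d) (z : Fin d → ℂ) :
    symbol a z = a.sum fun α t => (t : ℂ) * ∏ i, z i ^ α i := rfl

theorem symbol_avgMask (v : Fin d → ℤ) (a : Mask d) (z : Fin d → ℂ) (hz : ∀ i, z i ≠ 0) :
    symbol (avgMask v a) z = (1 + ∏ i, z i ^ v i) / 2 * symbol a z := by
  have h0 : ∀ α : Fin d → ℤ, ((0 : ℝ) : ℂ) * ∏ i, z i ^ α i = 0 := by simp
  have hadd : ∀ (α : Fin d → ℤ) (s t : ℝ), ((s + t : ℝ) : ℂ) * ∏ i, z i ^ α i =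
      (s : ℂ) * ∏ i, z i ^ α i + (t : ℂ) * ∏ i, z i ^ α i := by
    intros; push_cast; ring
  simp only [symbol_eq_sum, avgMask]
  rw [Finsupp.sum_smul_index' h0, Finsupp.sum]
  have h1 : ∀ b : Mask d, (b.support.sum fun α => (((1 / 2 : ℝ) • b α : ℝ) : ℂ) * ∏ i, z i ^ α i)
      = 1 / 2 * b.sum fun α t => (t : ℂ) * ∏ i, z i ^ α i := by
    intro b
    rw [Finsupp.sum, Finset.mul_sum]
    refine Finset.sum_congr rfl fun α _ => ?_
    rw [smul_eq_mul]
    push_cast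
    ring
  rw [h1, Finsupp.sum_add_index' h0 hadd, Finsupp.sum_mapDomain_index h0 hadd]
  have h2 : (a.sum fun α t => (t : ℂ) * ∏ i, z i ^ (α + v) i) =
      (∏ i, z i ^ v i) * a.sum fun α t => (t : ℂ) * ∏ i, z i ^ α i := by
    rw [Finsupp.sum, Finsupp.sum, Finset.mul_sum]
    refine Finset.sum_congr rfl fun α _ => ?_
    simp only [Pi.add_apply, zpow_add₀ (hz _), Finset.prod_mul_distrib]
    ring
  rw [h2]
  ring

theorem monomialHom_injective :
    Function.Injective fun α : Fin d → ℤ =>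
      (((Units.coeHom ℂ).comp (∏ i, (zpowGroupHom (α i)).comp (Pi.evalMonoidHom (fun _ => ℂˣ) i))) :
        (Fin d → ℂˣ) →* ℂ) := by
  intro α β h
  funext i
  have h1 := DFunLike.congr_fun h (Pi.mulSingle i (Units.mk0 (2 : ℂ) two_ne_zero))
  simp only [MonoidHom.comp_apply, MonoidHom.finsetProd_apply, Units.coeHom_apply,
    Pi.evalMonoidHom_apply, zpowGroupHom_apply] at h1
  rw [Finset.prod_eq_single i, Finset.prod_eq_single i] at h1
  · simp only [Pi.mulSingle_eq_same, Units.val_zpow_eq_zpow_val, Units.val_mk0] at h1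
    have h2 : ((2 : ℝ) ^ α i) = (2 : ℝ) ^ β i :=
      Complex.ofReal_injective (by simpa using h1)
    exact zpow_right_injective₀ (by norm_num) (by norm_num) h2
  all_goals simp +contextual [Pi.mulSingle_eq_of_ne]

theorem symbol_injective {a b : Mask d}
    (h : ∀ z : Fin d → ℂ, (∀ i, z i ≠ 0) → symbol a z = symbol b z) : a = b := by
  have hli := (linearIndependent_monoidHom (Fin d → ℂˣ) ℂ).comp _
    (monomialHom_injective (d := d))
  have key : ∀ c : Mask d, (∀ z : Fin d → ℂ, (∀ i, z i ≠ 0) → symbol c z = 0) → c = 0 := by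
    intro c hc
    have h1 := linearIndependent_iff'.1 hli c.support (fun α => (c α : ℂ)) (by
      funext z
      have := hc (fun i => (z i : ℂ)) fun i => (z i).ne_zero
      simpa [symbol, Finset.sum_apply] using this)
    ext α
    by_contra hα
    exact hα (by simpa using h1 α (Finsupp.mem_support_iff.2 hα))
  have h0 : ∀ α : Fin d → ℤ, ∀ z : Fin d → ℂ, ((0 : ℝ) : ℂ) * ∏ i, z i ^ α i = 0 := by simp
  refine sub_eq_zero.1 (key _ fun z hz => ?_)
  rw [symbol_eq_sum, Finsupp.sum_sub_index, ← symbol_eq_sum, ← symbol_eq_sum, h z hz, sub_self]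
  intros
  push_cast
  ring

theorem exists_avgs_mask (a : Mask d) (D : Multiset (Fin d → ℕ)) :
    ∃ b : Mask d, (∀ f, subdivOp b f = avgs (D.map fun v i => (v i : ℤ)) (subdivOp a f)) ∧
      ∀ z : Fin d → ℂ, (∀ i, z i ≠ 0) → symbol b z = smoothingSymbol D z * symbol a z := by
  induction D using Multiset.induction_on with
  | empty => exact ⟨a, fun f => by simp, fun z _ => by simp [smoothingSymbol]⟩
  | cons v D ih =>
    obtain ⟨b, hb, hbs⟩ := ih
    refine ⟨avgMask (fun i => (v i : ℤ)) b, fun f => ?_, fun z hz => ?_⟩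
    · rw [subdivOp_avgMask, hb, Multiset.map_cons, avgs_cons]
    · rw [symbol_avgMask _ _ _ hz, hbs z hz]
      simp only [smoothingSymbol, Multiset.map_cons, Multiset.prod_cons, zpow_natCast]
      ring

/-- A mask with symbol `s_D(z) a(z)` subdivides like `a` followed by averaging along `D`. -/
theorem subdivOp_eq_avgs {a c : Mask d} {D : Multiset (Fin d → ℕ)}
    (h : ∀ z : Fin d → ℂ, (∀ i, z i ≠ 0) → symbol c z = smoothingSymbol D z * symbol a z)
    (f : Seq d) : subdivOp c f = avgs (D.map fun v i => (v i : ℤ)) (subdivOp a f) := by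
  obtain ⟨b, hb, hbs⟩ := exists_avgs_mask a D
  rw [← hb, symbol_injective fun z hz => (h z hz).trans (hbs z hz).symm]

theorem smoothingSymbol_nsmul (D : Multiset (Fin d → ℕ)) (k : ℕ) (z : Fin d → ℂ) :
    smoothingSymbol (k • D) z = smoothingSymbol D z ^ k := by
  simp [smoothingSymbol, Multiset.map_nsmul, Multiset.prod_nsmul]

/-- `f` varies by at most `L` between neighbours in the supremum norm of `ℤ^d`. -/
def OscLE (L : ℝ) (f : Seq d) : Prop := ∀ α u : Fin d → ℤ, ‖u‖ ≤ 1 → |f (α + u) - f α| ≤ L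

theorem OscLE.nonneg {L : ℝ} {f : Seq d} (h : OscLE L f) : 0 ≤ L :=
  (abs_nonneg _).trans (h 0 0 (by simp))

theorem OscLE.mono {L L' : ℝ} {f : Seq d} (h : OscLE L f) (hL : L ≤ L') : OscLE L' f :=
  fun α u hu => (h α u hu).trans hL

theorem oscLE_of_bounded {B : ℝ} {f : Seq d} (h : ∀ α, |f α| ≤ B) : OscLE (2 * B) f := by
  intro α u _
  have := abs_sub (f (α + u)) (f α)
  linarith [h α, h (α + u)]

theorem norm_le_natCast_iff {w : Fin d → ℤ} {n : ℕ} : ‖w‖ ≤ n ↔ ∀ i, |w i| ≤ n := by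
  rw [pi_norm_le_iff_of_nonneg (Nat.cast_nonneg n)]
  refine forall_congr' fun i => ?_
  rw [Int.norm_eq_abs]
  exact_mod_cast Iff.rfl

theorem OscLE.le_nat_mul {L : ℝ} {f : Seq d} (h : OscLE L f) (n : ℕ) (α w : Fin d → ℤ)
    (hw : ‖w‖ ≤ n) : |f (α + w) - f α| ≤ L * n := by
  induction n generalizing w with
  | zero =>
    have : w = 0 := by simpa using hw
    simp [this]
  | succ n ih =>
    rw [norm_le_natCast_iff] at hw
    have h1 : ‖w - fun i => (w i).sign‖ ≤ n := by
      rw [norm_le_natCast_iff]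
      intro i
      have := hw i
      push_cast at this
      simp only [Pi.sub_apply]
      rcases lt_trichotomy (w i) 0 with hi | hi | hi
      · rw [Int.sign_eq_neg_one_of_neg hi]; rw [abs_le] at *; omega
      · simp [hi]
      · rw [Int.sign_eq_one_of_pos hi]; rw [abs_le] at *; omega
    have h2 : ‖(fun i => (w i).sign : Fin d → ℤ)‖ ≤ 1 := by
      have : ‖(fun i => (w i).sign : Fin d → ℤ)‖ ≤ (1 : ℕ) := by
        rw [norm_le_natCast_iff]
        intro i
        rcases lt_trichotomy (w i) 0 with hi | hi | hi
        · rw [Int.sign_eq_neg_one_of_neg hi]; simp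
        · simp [hi]
        · rw [Int.sign_eq_one_of_pos hi]; simp
      simpa using this
    have h3 := h (α + (w - fun i => (w i).sign)) _ h2
    have h4 := ih _ h1
    rw [add_assoc, sub_add_cancel] at h3
    have h5 := abs_sub_le (f (α + w)) (f (α + (w - fun i => (w i).sign))) (f α)
    push_cast
    linarith

theorem OscLE.le_mul_norm {L : ℝ} {f : Seq d} (h : OscLE L f) (α β : Fin d → ℤ) :
    |f β - f α| ≤ L * ‖β - α‖ := by
  have hn : ‖β - α‖ ≤ (⌊‖β - α‖⌋₊ : ℕ) := by
    rw [norm_le_natCast_iff]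
    intro i
    have h1 : (((β - α) i).natAbs : ℝ) ≤ ‖β - α‖ := by
      refine le_trans (le_of_eq ?_) (norm_le_pi_norm (β - α) i)
      rw [Int.norm_eq_abs, Nat.cast_natAbs, Int.cast_abs]
    have h2 := Nat.le_floor h1
    rw [Int.abs_eq_natAbs]
    exact_mod_cast h2
  have := h.le_nat_mul _ α (β - α) hn
  rw [add_sub_cancel] at this
  exact this.trans (mul_le_mul_of_nonneg_left (Nat.floor_le (norm_nonneg _)) h.nonneg)

theorem OscLE.avg {L : ℝ} {f : Seq d} (h : OscLE L f) (v : Fin d → ℤ) : OscLE L (avg v f) := by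
  intro α u hu
  have h1 := h α u hu
  have h2 := h (α - v) u hu
  simp only [Subdivision.avg, add_sub_right_comm α u v]
  rw [abs_le] at *
  constructor <;> linarith

theorem OscLE.avgs {L : ℝ} {f : Seq d} (h : OscLE L f) (E : Multiset (Fin d → ℤ)) :
    OscLE L (avgs E f) := by
  induction E using Multiset.induction_on with
  | empty => simpa
  | cons v E ih => rw [avgs_cons]; exact ih.avg v

theorem OscLE.abs_avgs_sub_le {L : ℝ} {f : Seq d} (h : OscLE L f) (E : Multiset (Fin d → ℤ))
    (α : Fin d → ℤ) : |Subdivision.avgs E f α - f α| ≤ L * (E.map (‖·‖)).sum := by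
  induction E using Multiset.induction_on with
  | empty => simp
  | cons v E ih =>
    rw [avgs_cons, Multiset.map_cons, Multiset.sum_cons]
    have h1 := (h.avgs E).le_mul_norm α (α - v)
    rw [sub_sub_cancel_left, norm_neg] at h1
    have h0 : 0 ≤ L * ‖v‖ := mul_nonneg h.nonneg (norm_nonneg v)
    simp only [Subdivision.avg]
    rw [abs_le] at *
    constructor <;> linarith

theorem bounded_avgs {B : ℝ} {f : Seq d} (h : ∀ α, |f α| ≤ B) (E : Multiset (Fin d → ℤ)) :
    ∀ α, |avgs E f α| ≤ B := by
  induction E using Multiset.induction_on with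
  | empty => simpa
  | cons v E ih =>
    intro α
    have h1 := ih α
    have h2 := ih (α - v)
    rw [avgs_cons, avg]
    rw [abs_le] at *
    constructor <;> linarith

/-- A bound for the support of a mask. -/
theorem exists_support_bound (a : Mask d) : ∃ M : ℕ, ∀ γ, a γ ≠ 0 → ‖γ‖ ≤ M := by
  obtain ⟨M, hM⟩ := (a.support.finite_toSet.image (‖·‖)).bddAbove
  obtain ⟨n, hn⟩ := exists_nat_ge M
  exact ⟨n, fun γ hγ => (hM ⟨γ, by simpa using hγ, rfl⟩).trans hn⟩

theorem sum_stencil_le (a : Mask d) (α : Fin d → ℤ) :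
    ∑ β ∈ stencil a α, |a (α - 2 • β)| ≤ ∑ γ ∈ a.support, |a γ| := by
  classical
  rw [← Finset.sum_image (f := fun γ => |a γ|) (g := fun β => α - 2 • β)
    (sub_two_smul_inj α).injOn]
  refine Finset.sum_le_sum_of_subset_of_nonneg (fun γ hγ => ?_) fun _ _ _ => abs_nonneg _
  obtain ⟨β, hβ, rfl⟩ := Finset.mem_image.1 hγ
  simpa using mem_stencil.1 hβ

theorem abs_subdivOp_le (a : Mask d) {f : Seq d} {B : ℝ} {α : Fin d → ℤ}
    (hB : 0 ≤ B) (h : ∀ β, a (α - 2 • β) ≠ 0 → |f β| ≤ B) :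
    |subdivOp a f α| ≤ (∑ γ ∈ a.support, |a γ|) * B := by
  rw [subdivOp_eq_sum]
  refine (Finset.abs_sum_le_sum_abs _ _).trans ?_
  refine le_trans ?_ (mul_le_mul_of_nonneg_right (sum_stencil_le a α) hB)
  rw [Finset.sum_mul]
  refine Finset.sum_le_sum fun β hβ => ?_
  rw [abs_mul]
  exact mul_le_mul_of_nonneg_left (h β (mem_stencil.1 hβ)) (abs_nonneg _)

theorem subdivOp_congr (a : Mask d) {f g : Seq d} {α : Fin d → ℤ}
    (h : ∀ β, a (α - 2 • β) ≠ 0 → f β = g β) : subdivOp a f α = subdivOp a g α := by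
  rw [subdivOp_eq_sum, subdivOp_eq_sum]
  exact Finset.sum_congr rfl fun β hβ => by rw [h β (mem_stencil.1 hβ)]

theorem refinedData_const (a : Mask d) (f : Seq d) (n : ℕ) :
    refinedData (fun _ => a) f n = (subdivLin a ^ n) f := by
  induction n with
  | zero => rfl
  | succ n ih => rw [pow_succ', Module.End.mul_apply, ← ih]; rfl

theorem subdivLin_pow_succ (a : Mask d) (n : ℕ) (f : Seq d) :
    (subdivLin a ^ (n + 1)) f = subdivOp a ((subdivLin a ^ n) f) := by
  rw [pow_succ', Module.End.mul_apply, subdivLin_apply]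

/-- `(S_a^n f)(α)` only depends on the values of `f` near `2^{-n} α`. -/
theorem subdivLin_pow_congr {a : Mask d} {M : ℕ} (hM : ∀ γ, a γ ≠ 0 → ‖γ‖ ≤ M) (n : ℕ)
    {f g : Seq d} {α : Fin d → ℤ}
    (h : ∀ β, ‖α - 2 ^ n • β‖ ≤ M * (2 ^ n - 1) → f β = g β) :
    (subdivLin a ^ n) f α = (subdivLin a ^ n) g α := by
  induction n generalizing α with
  | zero => exact h α (by simp)
  | succ n ih =>
    rw [subdivLin_pow_succ, subdivLin_pow_succ]
    refine subdivOp_congr a fun γ hγ => ih fun β hβ => h β ?_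
    have e : α - 2 ^ (n + 1) • β = (α - 2 • γ) + 2 • (γ - 2 ^ n • β) := by
      rw [pow_succ', mul_smul, smul_sub]; abel
    have h2 : ‖2 • (γ - 2 ^ n • β)‖ ≤ 2 * ‖γ - 2 ^ n • β‖ := by
      rw [two_smul, two_mul]; exact norm_add_le _ _
    rw [e, pow_succ']
    have h1 := hM _ hγ
    have h3 := norm_add_le (α - 2 • γ) (2 • (γ - 2 ^ n • β))
    nlinarith

theorem subdivLin_pow_shift (a : Mask d) (n : ℕ) (v : Fin d → ℤ) (f : Seq d) :
    (subdivLin a ^ n) (shift v f) = shift (2 ^ n • v) ((subdivLin a ^ n) f) := by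
  induction n with
  | zero => simp
  | succ n ih => rw [subdivLin_pow_succ, subdivLin_pow_succ, ih, subdivOp_shift, smul_smul, pow_succ']

/-- Reproduction of constants. -/
def ReproducesConst (a : Mask d) : Prop := ∀ t : ℝ, subdivOp a (fun _ => t) = fun _ => t

theorem ReproducesConst.pow {a : Mask d} (h : ReproducesConst a) (n : ℕ) (t : ℝ) :
    (subdivLin a ^ n) (fun _ => t) = fun _ => t := by
  induction n with
  | zero => rfl
  | succ n ih => rw [subdivLin_pow_succ, ih, h]

theorem norm_sub_pow_smul_floor_le (n : ℕ) (α : Fin d → ℤ) :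
    ‖α - 2 ^ n • (fun i => α i / 2 ^ n : Fin d → ℤ)‖ ≤ 2 ^ n := by
  have : ‖α - 2 ^ n • (fun i => α i / 2 ^ n : Fin d → ℤ)‖ ≤ ((2 ^ n : ℕ) : ℝ) := by
    rw [norm_le_natCast_iff]
    intro i
    have h2 : (0 : ℤ) < 2 ^ n := by positivity
    have h3 := Int.emod_nonneg (α i) h2.ne'
    have h4 := Int.emod_lt_of_pos (α i) h2
    have h5 := Int.emod_add_mul_ediv (α i) (2 ^ n)
    have h6 : (α - 2 ^ n • (fun i => α i / 2 ^ n : Fin d → ℤ)) i = α i % 2 ^ n := by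
      rw [Pi.sub_apply, Pi.smul_apply, nsmul_eq_mul]
      push_cast
      linarith
    rw [h6]
    push_cast
    rw [abs_le]
    constructor <;> linarith
  simpa using this

theorem norm_pow_two_smul (n : ℕ) (β : Fin d → ℤ) : ‖2 ^ n • β‖ = 2 ^ n * ‖β‖ := by
  have : (2 ^ n • β) = ((2 ^ n : ℤ)) • β := by
    ext i; simp
  rw [this, norm_smul, norm_pow, Int.norm_eq_abs]
  norm_num

open Classical in
/-- Small differences of the iterated mask make the iterated subdivision operator contract
oscillations. -/
theorem exists_oscLE_subdivLin_pow {a : Mask d} (h1 : ReproducesConst a) :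
    ∃ C : ℝ, 0 ≤ C ∧ ∀ (n : ℕ) (ε : ℝ), OscLE ε ((subdivLin a ^ n) (Pi.single 0 1)) →
      ∀ (L : ℝ) (f : Seq d), OscLE L f → OscLE (C * ε * L) ((subdivLin a ^ n) f) := by
  obtain ⟨M, hM⟩ := exists_support_bound a
  set B : Finset (Fin d → ℤ) := Finset.Icc (fun _ => -((M : ℤ) + 2)) (fun _ => (M : ℤ) + 2) with hB
  have memB : ∀ b : Fin d → ℤ, b ∈ B ↔ ‖b‖ ≤ (M + 2 : ℕ) := fun b => by
    rw [norm_le_natCast_iff, hB, Finset.mem_Icc, Pi.le_def, Pi.le_def, ← forall_and]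
    push_cast
    simp only [abs_le]
  refine ⟨B.card * (M + 2), by positivity, fun n ε hε L f hf α u hu => ?_⟩
  set β₀ : Fin d → ℤ := fun i => α i / 2 ^ n with hβ₀
  have hα := norm_sub_pow_smul_floor_le n α
  rw [← hβ₀] at hα
  set F : Seq d := ∑ b ∈ B, (f (β₀ + b) - f β₀) • shift (β₀ + b) (Pi.single 0 1) with hF
  have hFval : ∀ β, ‖β - β₀‖ ≤ (M + 2 : ℕ) → F β = f β - f β₀ := by
    intro β hβ
    simp only [hF, Finset.sum_apply, Pi.smul_apply, shift, smul_eq_mul]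
    rw [Finset.sum_eq_single (β - β₀)]
    · simp
    · intro b _ hb
      rw [Pi.single_eq_of_ne, mul_zero]
      intro h
      exact hb (by rw [eq_comm, ← sub_eq_zero]; rw [← h]; abel)
    · intro hb
      exact absurd ((memB _).2 hβ) hb
  have hval : ∀ u : Fin d → ℤ, ‖u‖ ≤ 1 →
      (subdivLin a ^ n) f (α + u) = (subdivLin a ^ n) F (α + u) + f β₀ := by
    intro u hu
    have e1 : (subdivLin a ^ n) (f - fun _ => f β₀) (α + u) = (subdivLin a ^ n) F (α + u) := by
      refine subdivLin_pow_congr hM n fun β hβ => ?_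
      rw [hFval β]
      · simp
      · have e : 2 ^ n • (β - β₀) = (α - 2 ^ n • β₀) + u - (α + u - 2 ^ n • β) := by
          rw [smul_sub]; abel
        have i1 : ‖2 ^ n • (β - β₀)‖ ≤ 2 ^ n + 1 + M * (2 ^ n - 1) := by
          rw [e]
          refine (norm_sub_le _ _).trans (add_le_add ((norm_add_le _ _).trans ?_) hβ)
          exact add_le_add hα hu
        have i2 : (1 : ℝ) ≤ 2 ^ n := one_le_pow₀ (by norm_num)
        rw [norm_pow_two_smul] at i1
        have i3 : (2 : ℝ) ^ n * ‖β - β₀‖ ≤ 2 ^ n * ((M + 2 : ℕ) : ℝ) := by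
          push_cast
          have : (0 : ℝ) ≤ M := Nat.cast_nonneg M
          nlinarith
        exact le_of_mul_le_mul_left i3 (by positivity)
    rw [map_sub, h1.pow, Pi.sub_apply] at e1
    linarith
  have h0 := hval 0 (by simp)
  rw [add_zero] at h0
  rw [hval u hu, h0, add_sub_add_right_eq_sub]
  have hFn : ∀ γ, (subdivLin a ^ n) F γ = ∑ b ∈ B, (f (β₀ + b) - f β₀) *
      (subdivLin a ^ n) (Pi.single 0 1) (γ - 2 ^ n • (β₀ + b)) := by
    intro γ
    simp only [hF, map_sum, map_smul, subdivLin_pow_shift, Finset.sum_apply, Pi.smul_apply,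
      smul_eq_mul, shift]
  rw [hFn, hFn, ← Finset.sum_sub_distrib]
  refine (Finset.abs_sum_le_sum_abs _ _).trans ((Finset.sum_le_card_nsmul B _
    ((M + 2) * ε * L) fun b hb => ?_).trans (le_of_eq ?_))
  · rw [← mul_sub, abs_mul, add_sub_right_comm]
    have j1 := hf.le_nat_mul (M + 2) β₀ b ((memB b).1 hb)
    have j2 := hε (α - 2 ^ n • (β₀ + b)) u hu
    push_cast at j1
    calc _ ≤ (L * (M + 2)) * ε := by
          exact mul_le_mul j1 j2 (abs_nonneg _) ((abs_nonneg _).trans j1)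
      _ = _ := by ring
  · rw [nsmul_eq_mul]; ring

theorem abs_subdivOp_sub_le {a : Mask d} (h1 : ReproducesConst a) :
    ∃ C : ℝ, 0 ≤ C ∧ ∀ (L : ℝ) (f : Seq d), OscLE L f → ∀ α : Fin d → ℤ,
      |subdivOp a f α - f (fun i => α i / 2)| ≤ C * L := by
  obtain ⟨M, hM⟩ := exists_support_bound a
  refine ⟨(∑ γ ∈ a.support, |a γ|) * (M + 2), by positivity, fun L f hf α => ?_⟩
  set β₀ : Fin d → ℤ := fun i => α i / 2 with hβ₀
  have e : subdivOp a f α - f β₀ = subdivOp a (f - fun _ => f β₀) α := by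
    rw [subdivOp_sub, h1]; rfl
  have hα := norm_sub_pow_smul_floor_le 1 α
  simp only [pow_one, ← hβ₀] at hα
  have hL := hf.nonneg
  rw [e, mul_assoc]
  refine abs_subdivOp_le a (by positivity) fun β hβ => ?_
  have h2 : 2 • (β - β₀) = (α - 2 • β₀) - (α - 2 • β) := by rw [smul_sub]; abel
  have h3 := norm_pow_two_smul 1 (β - β₀)
  rw [pow_one, pow_one] at h3
  have h4 : ‖2 • (β - β₀)‖ ≤ 2 + M := by
    rw [h2]; exact (norm_sub_le _ _).trans (add_le_add hα (hM _ hβ))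
  have h5 := hf.le_mul_norm β₀ β
  simp only [Pi.sub_apply]
  have h6 : ‖β - β₀‖ ≤ M + 2 := by
    have : (0 : ℝ) ≤ M := Nat.cast_nonneg M
    linarith
  nlinarith

/-- The point `2^{-n} α` of the dyadic grid of level `n`. -/
noncomputable def gridPt (n : ℕ) (α : Fin d → ℤ) : Fin d → ℝ := fun i => (α i : ℝ) / 2 ^ n

/-- The index of the cell of level `n` that contains `x`. -/
noncomputable def cell (n : ℕ) (x : Fin d → ℝ) : Fin d → ℤ := fun i => ⌊2 ^ n * x i⌋

/-- The sequences `h n`, regarded as data on the grids of level `n`, converge uniformly to `g`. -/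
def IsGridLimit (h : ℕ → Seq d) (g : (Fin d → ℝ) → ℝ) : Prop :=
  ∀ ε > 0, ∀ᶠ n in atTop, ∀ α, |g (gridPt n α) - h n α| < ε

theorem isLimitFunction_iff {c : ℕ → Mask d} {f : Seq d} {g : (Fin d → ℝ) → ℝ} :
    IsLimitFunction c f g ↔ IsGridLimit (refinedData c f) g := by
  rw [IsLimitFunction, Metric.tendstoUniformly_iff, IsGridLimit]
  refine forall₂_congr fun ε _ => ?_
  conv_rhs => rw [← map_add_atTop_eq_nat 1, eventually_map]
  refine eventually_congr (Eventually.of_forall fun n => forall_congr' fun α => ?_)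
  have : (fun i => (2 : ℝ) ^ (-((n : ℤ) + 1)) * (α i : ℝ)) = gridPt (n + 1) α := by
    funext i
    rw [gridPt, zpow_neg, div_eq_inv_mul]
    norm_cast
  rw [this, dist_comm, Real.dist_eq, sub_zero]

theorem norm_gridPt (n : ℕ) (α : Fin d → ℤ) : ‖gridPt n α‖ = ‖α‖ / 2 ^ n := by
  have : gridPt n α = ((2 : ℝ) ^ n)⁻¹ • fun i => (α i : ℝ) := by
    funext i
    simp [gridPt, div_eq_inv_mul]
  have h2 : ‖(fun i => (α i : ℝ))‖ = ‖α‖ := by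
    simp only [Pi.norm_def]
    congr 1
  rw [this, norm_smul, h2, div_eq_inv_mul, norm_inv, norm_pow]
  norm_num

theorem gridPt_add (n : ℕ) (α β : Fin d → ℤ) : gridPt n (α + β) = gridPt n α + gridPt n β := by
  funext i
  simp [gridPt, add_div]

theorem gridPt_succ_two_smul (n : ℕ) (α : Fin d → ℤ) : gridPt (n + 1) (2 • α) = gridPt n α := by
  funext i
  simp only [gridPt, Pi.smul_apply, nsmul_eq_mul, pow_succ]
  push_cast
  field_simp

theorem norm_gridPt_cell_sub_le (n : ℕ) (x : Fin d → ℝ) :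
    ‖gridPt n (cell n x) - x‖ ≤ (1 / 2) ^ n := by
  refine (pi_norm_le_iff_of_nonneg (by positivity)).2 fun i => ?_
  have h1 := Int.floor_le (2 ^ n * x i)
  have h2 := Int.lt_floor_add_one (2 ^ n * x i)
  have h3 : (0 : ℝ) < 2 ^ n := by positivity
  have e : (gridPt n (cell n x) - x) i = (1 / 2) ^ n * (⌊2 ^ n * x i⌋ - 2 ^ n * x i) := by
    simp only [Pi.sub_apply, gridPt, cell, one_div, inv_pow]
    field_simp
  rw [e, norm_mul, Real.norm_of_nonneg (by positivity : (0 : ℝ) ≤ (1 / 2) ^ n)]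
  refine mul_le_of_le_one_right (by positivity) ?_
  rw [Real.norm_eq_abs, abs_le]
  constructor <;> linarith

theorem tendsto_half_pow : Tendsto (fun n : ℕ => (1 / 2 : ℝ) ^ n) atTop (𝓝 0) :=
  tendsto_pow_atTop_nhds_zero_of_lt_one (by norm_num) (by norm_num)

theorem tendsto_gridPt_cell (x : Fin d → ℝ) :
    Tendsto (fun n => gridPt n (cell n x)) atTop (𝓝 x) :=
  tendsto_iff_norm_sub_tendsto_zero.2
    (squeeze_zero (fun _ => norm_nonneg _) (norm_gridPt_cell_sub_le · x) tendsto_half_pow)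

theorem tendsto_gridPt_const (α : Fin d → ℤ) :
    Tendsto (fun n => gridPt n α) atTop (𝓝 0) := by
  refine tendsto_zero_iff_norm_tendsto_zero.2 ?_
  simp only [norm_gridPt, div_eq_mul_inv, ← inv_pow]
  simpa using tendsto_half_pow.const_mul ‖α‖

theorem IsGridLimit.tendsto {h : ℕ → Seq d} {g : (Fin d → ℝ) → ℝ} (hg : IsGridLimit h g)
    {x : Fin d → ℝ} (hc : ContinuousAt g x) {α : ℕ → Fin d → ℤ}
    (hα : Tendsto (fun n => gridPt n (α n)) atTop (𝓝 x)) :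
    Tendsto (fun n => h n (α n)) atTop (𝓝 (g x)) := by
  have h1 : Tendsto (fun n => g (gridPt n (α n)) - h n (α n)) atTop (𝓝 0) := by
    refine Metric.tendsto_nhds.2 fun ε hε => (hg ε hε).mono fun n hn => ?_
    rw [Real.dist_eq, sub_zero]
    exact hn _
  simpa using (hc.tendsto.comp hα).sub h1

/-- The sum rules: a convergent scheme reproduces constants. -/
theorem StationaryConvergent.reproducesConst {a : Mask d} (ha : StationaryConvergent a) :
    ReproducesConst a := by
  obtain ⟨-, f₀, -, -, g, hg0, hgc, hg⟩ := ha
  rw [isLimitFunction_iff] at hg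
  obtain ⟨x, hx⟩ := Function.ne_iff.1 hg0
  have hc : ContinuousAt g x := hgc.continuous.continuousAt
  intro t
  funext α
  have hα : Tendsto (fun n => gridPt n (α + 2 • cell (n - 1) x)) atTop (𝓝 x) := by
    rw [← tendsto_add_atTop_iff_nat 1]
    simp only [gridPt_add, Nat.add_sub_cancel, gridPt_succ_two_smul]
    simpa using ((tendsto_add_atTop_iff_nat 1).2 (tendsto_gridPt_const α)).add
      (tendsto_gridPt_cell x)
  have l1 := (tendsto_add_atTop_iff_nat 1).2 (hg.tendsto hc hα)
  have e : ∀ n, refinedData (fun _ => a) f₀ (n + 1) (α + 2 • cell (n + 1 - 1) x) =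
      ∑ β ∈ stencil a α, a (α - 2 • β) * refinedData (fun _ => a) f₀ n (β + cell n x) := by
    intro n
    have := congrFun (subdivOp_shift a (-cell n x) (refinedData (fun _ => a) f₀ n)) α
    rw [subdivOp_eq_sum] at this
    simp only [shift, sub_neg_eq_add, smul_neg] at this
    rw [this]
    rfl
  simp only [e] at l1
  have l2 : Tendsto (fun n => ∑ β ∈ stencil a α,
      a (α - 2 • β) * refinedData (fun _ => a) f₀ n (β + cell n x)) atTop
      (𝓝 (∑ β ∈ stencil a α, a (α - 2 • β) * g x)) := by
    refine tendsto_finsetSum _ fun β _ => (hg.tendsto hc ?_).const_mul _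
    simp only [gridPt_add]
    simpa using (tendsto_gridPt_const β).add (tendsto_gridPt_cell x)
  have h3 := tendsto_nhds_unique l1 l2
  rw [← Finset.sum_mul] at h3
  have h4 : ∑ β ∈ stencil a α, a (α - 2 • β) = 1 :=
    mul_right_cancel₀ hx (by rw [one_mul]; exact h3.symm)
  rw [subdivOp_eq_sum, ← Finset.sum_mul, h4, one_mul]

theorem memℓp_top_single : Memℓp (Pi.single 0 1 : Seq d) ⊤ := by
  refine memℓp_infty ⟨1, ?_⟩
  rintro _ ⟨α, rfl⟩
  rcases eq_or_ne α 0 with rfl | h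
  · simp
  · simp [Pi.single_eq_of_ne h]

/-- The neighbouring coefficients of the iterated masks of a convergent scheme approach
each other uniformly. -/
theorem StationaryConvergent.eventually_oscLE {a : Mask d} (ha : StationaryConvergent a)
    {ε : ℝ} (hε : 0 < ε) :
    ∀ᶠ n in atTop, OscLE ε ((subdivLin a ^ n) (Pi.single 0 1)) := by
  obtain ⟨M, hM⟩ := exists_support_bound a
  obtain ⟨g, hgc, hg⟩ := ha.1 _ memℓp_top_single
  rw [isLimitFunction_iff] at hg
  have hu := (isCompact_closedBall (0 : Fin d → ℝ) (M + 3)).uniformContinuousOn_of_continuous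
    (f := g) hgc.continuous.continuousOn
  obtain ⟨δ, hδ, hu⟩ := Metric.uniformContinuousOn_iff.1 hu (ε / 3) (by positivity)
  have hvan : ∀ n γ, (M : ℝ) * 2 ^ n < ‖γ‖ →
      (subdivLin a ^ n) (Pi.single 0 1) γ = 0 := by
    intro n γ hγ
    have := subdivLin_pow_congr hM n (f := (Pi.single 0 1 : Seq d)) (g := 0) (α := γ) fun β hβ => by
      rw [Pi.single_eq_of_ne, Pi.zero_apply]
      rintro rfl
      rw [smul_zero, sub_zero] at hβ
      have : (0 : ℝ) ≤ M := Nat.cast_nonneg M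
      linarith
    rw [this, map_zero]
    rfl
  filter_upwards [hg (ε / 3) (by positivity), tendsto_half_pow.eventually (gt_mem_nhds hδ)]
    with n h1 h2 α u hu1
  simp only [refinedData_const] at h1
  have i2 : (1 : ℝ) ≤ 2 ^ n := one_le_pow₀ (by norm_num)
  by_cases hα : ‖α‖ ≤ (M + 2) * 2 ^ n
  · have n1 : ‖gridPt n α‖ ≤ M + 2 := by
      rw [norm_gridPt]; exact (div_le_iff₀ (by positivity)).2 hα
    have n2 : ‖gridPt n u‖ ≤ (1 / 2) ^ n := by
      rw [norm_gridPt, one_div, inv_pow, ← one_div]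
      gcongr
    have n3 : ((1 : ℝ) / 2) ^ n ≤ 1 := pow_le_one₀ (by norm_num) (by norm_num)
    have n4 := norm_add_le (gridPt n α) (gridPt n u)
    have := hu (gridPt n (α + u)) (by
      rw [mem_closedBall_zero_iff, gridPt_add]; linarith) (gridPt n α) (by
      rw [mem_closedBall_zero_iff]; linarith) (by
      rw [dist_eq_norm, gridPt_add, add_sub_cancel_left]; linarith)
    rw [Real.dist_eq] at this
    have k1 := h1 α
    have k2 := h1 (α + u)
    rw [abs_lt] at *
    rw [abs_le]
    constructor <;> linarith
  · push Not at hα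
    have n1 : ‖α‖ ≤ ‖α + u‖ + ‖u‖ := by simpa using norm_sub_le (α + u) u
    rw [hvan n α (by nlinarith), hvan n (α + u) (by nlinarith)]
    simpa using hε.le

/-- The oscillation decays geometrically under iteration of a convergent subdivision operator. -/
theorem StationaryConvergent.exists_geometric_decay {a : Mask d} (ha : StationaryConvergent a) :
    ∃ C ρ : ℝ, 0 ≤ C ∧ 0 ≤ ρ ∧ ρ < 1 ∧ ∀ (n : ℕ) (L : ℝ) (f : Seq d), OscLE L f →
      OscLE (C * ρ ^ n * L) ((subdivLin a ^ n) f) := by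
  obtain ⟨C, hC, hdec⟩ := exists_oscLE_subdivLin_pow ha.reproducesConst
  obtain ⟨m, hm, hm1⟩ := ((ha.eventually_oscLE (ε := 1 / (2 * (C + 1))) (by positivity)).and
    (eventually_ge_atTop 1)).exists
  have hhalf : ∀ (L : ℝ) (f : Seq d), OscLE L f → OscLE (1 / 2 * L) ((subdivLin a ^ m) f) := by
    intro L f hf
    refine (hdec m _ hm L f hf).mono (mul_le_mul_of_nonneg_right ?_ hf.nonneg)
    rw [mul_one_div, div_le_div_iff₀ (by positivity) (by norm_num)]
    linarith
  obtain ⟨K, hK1, hK⟩ : ∃ K : ℝ, 1 ≤ K ∧ ∀ (L : ℝ) (f : Seq d), OscLE L f →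
      OscLE (K * L) (subdivOp a f) := by
    have hb : ∀ α, |subdivOp a (Pi.single 0 1) α| ≤ (∑ γ ∈ a.support, |a γ|) * 1 := fun α =>
      abs_subdivOp_le a zero_le_one fun β _ => by
        rcases eq_or_ne β 0 with rfl | h
        · simp
        · simp [Pi.single_eq_of_ne h]
    refine ⟨max 1 (C * (2 * ((∑ γ ∈ a.support, |a γ|) * 1))), le_max_left _ _, fun L f hf => ?_⟩
    have := hdec 1 _ (by rw [pow_one]; exact oscLE_of_bounded hb) L f hf
    rw [pow_one] at this
    exact this.mono (mul_le_mul_of_nonneg_right (le_max_right _ _) hf.nonneg)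
  have hKi : ∀ (i : ℕ) (L : ℝ) (f : Seq d), OscLE L f →
      OscLE (K ^ i * L) ((subdivLin a ^ i) f) := by
    intro i L f hf
    induction i with
    | zero => simpa using hf
    | succ i ih => rw [subdivLin_pow_succ, pow_succ', mul_assoc]; exact hK _ _ ih
  have hq : ∀ (q : ℕ) (L : ℝ) (f : Seq d), OscLE L f →
      OscLE ((1 / 2) ^ q * L) ((subdivLin a ^ (m * q)) f) := by
    intro q L f hf
    induction q with
    | zero => simpa using hf
    | succ q ih =>
      rw [Nat.mul_succ, add_comm (m * q), pow_add (subdivLin a), Module.End.mul_apply, pow_succ' (1 / 2 : ℝ),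
        mul_assoc]
      exact hhalf _ _ ih
  have hm0 : (1 : ℝ) ≤ m := by exact_mod_cast hm1
  set ρ : ℝ := 1 - 1 / (2 * m) with hρ
  have hinv : 1 / (2 * (m : ℝ)) ≤ 1 / 2 := by
    rw [div_le_div_iff₀ (by positivity) (by norm_num)]; linarith
  have hρ0 : 0 < ρ := by linarith
  have hρ1 : ρ < 1 := by
    have : 0 < 1 / (2 * (m : ℝ)) := by positivity
    linarith
  have hρm : 1 / 2 ≤ ρ ^ m := by
    have := one_add_mul_le_pow (a := -(1 / (2 * (m : ℝ)))) (by linarith) m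
    rw [← sub_eq_add_neg, ← hρ] at this
    refine le_trans (le_of_eq ?_) this
    field_simp
    norm_num
  refine ⟨2 * K ^ m, ρ, by positivity, hρ0.le, hρ1, fun n L f hf => ?_⟩
  have h := hKi (n % m) _ _ (hq (n / m) L f hf)
  rw [← Module.End.mul_apply, ← pow_add, Nat.mod_add_div] at h
  refine h.mono ?_
  rw [← mul_assoc]
  refine mul_le_mul_of_nonneg_right ?_ hf.nonneg
  have b1 : K ^ (n % m) ≤ K ^ m := pow_le_pow_right₀ hK1 (Nat.mod_lt n hm1).le
  have b2 : (1 / 2 : ℝ) ^ (n / m) ≤ 2 * ρ ^ n := by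
    calc (1 / 2 : ℝ) ^ (n / m) = 2 * (1 / 2) ^ (n / m + 1) := by rw [pow_succ]; ring
      _ ≤ 2 * (ρ ^ m) ^ (n / m + 1) := by gcongr
      _ ≤ 2 * ρ ^ n := by
        rw [← pow_mul]
        refine mul_le_mul_of_nonneg_left (pow_le_pow_of_le_one hρ0.le hρ1.le ?_) (by norm_num)
        have := Nat.mod_add_div n m
        have := Nat.mod_lt n hm1
        rw [mul_add]
        omega
  calc K ^ (n % m) * (1 / 2) ^ (n / m) ≤ K ^ m * (2 * ρ ^ n) := by gcongr
    _ = _ := by ring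

theorem bounded_subdivOp (a : Mask d) {f : Seq d} (h : ∃ B, ∀ α, |f α| ≤ B) :
    ∃ B, ∀ α, |subdivOp a f α| ≤ B := by
  obtain ⟨B, hB⟩ := h
  exact ⟨_, fun α => abs_subdivOp_le a ((abs_nonneg _).trans (hB 0)) fun β _ => hB β⟩

theorem cell_succ_ediv_two (n : ℕ) (x : Fin d → ℝ) :
    (fun i => cell (n + 1) x i / 2) = cell n x := by
  funext i
  have := Int.floor_div_natCast (2 ^ (n + 1) * x i) 2
  simp only [cell]
  push_cast at this
  rw [← this, pow_succ]
  congr 1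
  ring

theorem cell_gridPt (n : ℕ) (α : Fin d → ℤ) : cell n (gridPt n α) = α := by
  funext i
  rw [cell, gridPt, mul_div_cancel₀ _ (by positivity), Int.floor_intCast]

theorem norm_cell_sub_le {n : ℕ} {x y : Fin d → ℝ} (h : 2 ^ n * ‖y - x‖ ≤ 1) :
    ‖cell n y - cell n x‖ ≤ 1 := by
  have : ‖cell n y - cell n x‖ ≤ (1 : ℕ) := by
    rw [norm_le_natCast_iff]
    intro i
    have h1 : |2 ^ n * y i - 2 ^ n * x i| ≤ 1 := by
      rw [← mul_sub, abs_mul, abs_of_pos (by positivity : (0 : ℝ) < 2 ^ n)]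
      exact (mul_le_mul_of_nonneg_left (norm_le_pi_norm (y - x) i) (by positivity)).trans h
    have a1 := Int.floor_le (2 ^ n * x i)
    have a2 := Int.lt_floor_add_one (2 ^ n * x i)
    have a3 := Int.floor_le (2 ^ n * y i)
    have a4 := Int.lt_floor_add_one (2 ^ n * y i)
    rw [abs_le] at h1
    have b1 : ⌊2 ^ n * y i⌋ < ⌊2 ^ n * x i⌋ + 2 := by
      rw [← Int.cast_lt (R := ℝ)]; push_cast; linarith
    have b2 : ⌊2 ^ n * x i⌋ < ⌊2 ^ n * y i⌋ + 2 := by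
      rw [← Int.cast_lt (R := ℝ)]; push_cast; linarith
    simp only [Pi.sub_apply, cell]
    rw [abs_le]
    constructor <;> push_cast <;> linarith
  simpa using this

/-- Data whose refinement steps have summable errors and whose oscillation tends to zero have a
continuous limit. -/
theorem exists_continuous_gridLimit {h : ℕ → Seq d} {N : ℕ} {u L : ℕ → ℝ} (hu : Summable u)
    (hstep : ∀ n, ∀ α : Fin d → ℤ, |h (N + (n + 1)) α - h (N + n) (fun i => α i / 2)| ≤ u n)
    (hL : Tendsto L atTop (𝓝 0)) (hosc : ∀ n, OscLE (L n) (h (N + n))) :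
    ∃ g : (Fin d → ℝ) → ℝ, Continuous g ∧ IsGridLimit h g := by
  have hd : ∀ x n, dist (h (N + n) (cell (N + n) x)) (h (N + (n + 1)) (cell (N + (n + 1)) x)) ≤
      u n := by
    intro x n
    rw [dist_comm, Real.dist_eq, ← cell_succ_ediv_two (N + n) x]
    exact hstep n (cell (N + n + 1) x)
  have hlim : ∀ x, ∃ y, Tendsto (fun n => h (N + n) (cell (N + n) x)) atTop (𝓝 y) := fun x =>
    cauchySeq_tendsto_of_complete (cauchySeq_of_dist_le_of_summable u (hd x) hu)
  choose g hg using hlim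
  set T : ℕ → ℝ := fun n => ∑' m, u (n + m) with hT
  have hT0 : Tendsto T atTop (𝓝 0) := by
    simpa only [hT, add_comm] using tendsto_sum_nat_add u
  have hgT : ∀ n x, |h (N + n) (cell (N + n) x) - g x| ≤ T n := fun n x =>
    dist_le_tsum_of_dist_le_of_tendsto u (hd x) hu (hg x) n
  refine ⟨g, ?_, ?_⟩
  · rw [Metric.continuous_iff]
    intro x ε hε
    obtain ⟨n, h1, h2⟩ := ((hT0.eventually (gt_mem_nhds (by positivity : 0 < ε / 3))).and
      (hL.eventually (gt_mem_nhds (by positivity : 0 < ε / 3)))).exists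
    refine ⟨1 / 2 ^ (N + n), by positivity, fun y hy => ?_⟩
    have hy' : 2 ^ (N + n) * ‖y - x‖ ≤ 1 := by
      rw [dist_eq_norm, lt_div_iff₀ (by positivity)] at hy
      linarith
    have h3 := hosc n (cell (N + n) x) _ (norm_cell_sub_le hy')
    rw [add_sub_cancel] at h3
    have h4 := hgT n x
    have h5 := hgT n y
    rw [Real.dist_eq]
    rw [abs_le] at h3 h4 h5
    rw [abs_lt]
    constructor <;> linarith
  · intro ε hε
    have : ∀ᶠ n in atTop, ∀ α, |g (gridPt (n + N) α) - h (n + N) α| < ε := by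
      filter_upwards [hT0.eventually (gt_mem_nhds hε)] with n hn α
      have := hgT n (gridPt (n + N) α)
      rw [add_comm N n, cell_gridPt, abs_sub_comm] at this
      exact this.trans_lt hn
    rw [← map_add_atTop_eq_nat N, eventually_map]
    exact this

/-- Averaging along a number of directions that grows linearly with the level preserves the
convergence of a stationary scheme. -/
theorem StationaryConvergent.exists_gridLimit {a : Mask d} (ha : StationaryConvergent a)
    {h : ℕ → Seq d} {E : ℕ → Multiset (Fin d → ℤ)} {N : ℕ} {K : ℝ}
    (hrec : ∀ n, h (N + (n + 1)) = avgs (E n) (subdivOp a (h (N + n))))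
    (hE : ∀ n, ((E n).map (‖·‖)).sum ≤ K * (n + 1)) (hb : ∃ B, ∀ α, |h N α| ≤ B) :
    ∃ g : (Fin d → ℝ) → ℝ, Continuous g ∧ IsGridLimit h g := by
  obtain ⟨C, ρ, hC, hρ0, hρ1, hdec⟩ := ha.exists_geometric_decay
  obtain ⟨C', hC', hfloor⟩ := abs_subdivOp_sub_le ha.reproducesConst
  obtain ⟨B, hB⟩ := hb
  have hpow : ∀ n, ∃ F, h (N + n) = avgs F ((subdivLin a ^ n) (h N)) := by
    intro n
    induction n with
    | zero => exact ⟨0, rfl⟩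
    | succ n ih =>
      obtain ⟨F, hF⟩ := ih
      exact ⟨E n + F.map (2 • ·), by
        rw [hrec, hF, subdivOp_avgs, avgs_add, subdivLin_pow_succ]⟩
  set L : ℕ → ℝ := fun n => C * ρ ^ n * (2 * B) with hL
  have hosc : ∀ n, OscLE (L n) (h (N + n)) := by
    intro n
    obtain ⟨F, hF⟩ := hpow n
    rw [hF]
    exact (hdec n _ _ (oscLE_of_bounded hB)).avgs F
  have hgeo : Summable fun n : ℕ => ρ ^ n := summable_geometric_of_lt_one hρ0 hρ1
  have hgeo1 : Summable fun n : ℕ => (n : ℝ) * ρ ^ n := by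
    have := summable_pow_mul_geometric_of_norm_lt_one 1
      (show ‖ρ‖ < 1 by rwa [Real.norm_of_nonneg hρ0])
    simpa using this
  have hu : Summable fun n => C * ρ ^ 1 * L n * (K * (n + 1)) + C' * L n := by
    refine (((hgeo.add hgeo1).mul_left (C * ρ * C * (2 * B) * K)).add
      (hgeo.mul_left (C' * C * (2 * B)))).congr fun n => ?_
    simp only [hL]
    ring
  refine exists_continuous_gridLimit hu (fun n α => ?_) (L := L) ?_ hosc
  · have h1 := hdec 1 _ _ (hosc n)
    rw [pow_one (subdivLin a), subdivLin_apply] at h1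
    have h2 := h1.abs_avgs_sub_le (E n) α
    have h3 := hfloor _ _ (hosc n) α
    have h4 := mul_le_mul_of_nonneg_left (hE n) h1.nonneg
    rw [hrec]
    exact (abs_sub_le _ _ _).trans (add_le_add (h2.trans h4) h3)
  · have := (tendsto_pow_atTop_nhds_zero_of_lt_one hρ0 hρ1).const_mul C |>.mul_const (2 * B)
    simpa using this

theorem gridPt_nsmul (n m : ℕ) (v : Fin d → ℤ) :
    gridPt n (m • v) = ((m : ℝ) / 2 ^ n) • fun i => (v i : ℝ) := by
  funext i
  simp only [gridPt, Pi.smul_apply, nsmul_eq_mul, smul_eq_mul]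
  push_cast
  ring

theorem sum_diff (v : Fin d → ℤ) (f : Seq d) (α : Fin d → ℤ) (m : ℕ) :
    ∑ i ∈ Finset.range m, diff v f (α + (i + 1) • v) = f (α + m • v) - f α := by
  have h := Finset.sum_range_sub (fun i => f (α + i • v)) m
  simp only [zero_smul, add_zero] at h
  rw [← h]
  refine Finset.sum_congr rfl fun i _ => ?_
  rw [diff, succ_nsmul, ← add_assoc, add_sub_cancel_right]

/-- `g` has increments along `v` controlled by the values of `g'`, as a function with continuous
directional derivative `g'` along `v` has. -/
def HasDirIncrements (v : Fin d → ℝ) (g g' : (Fin d → ℝ) → ℝ) : Prop :=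
  ∀ (x₀ : Fin d → ℝ) (δ A ε : ℝ), 0 < ε → (∀ y ∈ Metric.ball x₀ δ, |g' y - A| ≤ ε) →
    ∀ x ∈ Metric.ball x₀ δ, ∀ t : ℝ, x + t • v ∈ Metric.ball x₀ δ →
      |g (x + t • v) - g x - t * A| ≤ 2 * ε * |t|

theorem IsGridLimit.hasDirIncrements {h h' : ℕ → Seq d} {g g' : (Fin d → ℝ) → ℝ}
    {v : Fin d → ℤ} (hh : ∀ n, h' n = (2 : ℝ) ^ n • diff v (h n)) (hgc : Continuous g)
    (hg : IsGridLimit h g) (hg' : IsGridLimit h' g') :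
    HasDirIncrements (fun i => (v i : ℝ)) g g' := by
  intro x₀ δ A ε hε hA
  set w : Fin d → ℝ := fun i => (v i : ℝ) with hw
  have key : ∀ x ∈ Metric.ball x₀ δ, ∀ t : ℝ, 0 ≤ t → x + t • w ∈ Metric.ball x₀ δ →
      |g (x + t • w) - g x - t * A| ≤ 2 * ε * t := by
    intro x hx t ht hxt
    set m : ℕ → ℕ := fun n => ⌊2 ^ n * t⌋₊ with hm
    have hmt : ∀ n, (m n : ℝ) / 2 ^ n ≤ t := fun n => by
      rw [div_le_iff₀ (by positivity), mul_comm t]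
      exact Nat.floor_le (by positivity)
    have hmlim : Tendsto (fun n => (m n : ℝ) / 2 ^ n) atTop (𝓝 t) := by
      have h1 := tendsto_const_nhds (x := t) (f := atTop (α := ℕ)) |>.sub tendsto_half_pow
      rw [sub_zero] at h1
      refine tendsto_of_tendsto_of_tendsto_of_le_of_le h1 tendsto_const_nhds (fun n => ?_) hmt
      have := Nat.lt_floor_add_one (2 ^ n * t)
      simp only [one_div, inv_pow]
      rw [le_div_iff₀ (by positivity), sub_mul, inv_mul_cancel₀ (by positivity)]
      simp only [hm]
      linarith
    have l1 := hg.tendsto (x := x) hgc.continuousAt (tendsto_gridPt_cell x)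
    have l2 := hg.tendsto (x := x + t • w) hgc.continuousAt
      (α := fun n => cell n x + m n • v) (by
        simp only [gridPt_add, gridPt_nsmul]
        exact (tendsto_gridPt_cell x).add (hmlim.smul_const w))
    have l3 := ((l2.sub l1).sub (hmlim.mul_const A)).abs
    have l4 := hmlim.const_mul (2 * ε)
    refine le_of_tendsto_of_tendsto l3 l4 ?_
    rw [mem_ball_iff_norm] at hx hxt
    have hlt : 0 < δ - max ‖x - x₀‖ ‖x + t • w - x₀‖ := sub_pos.2 (max_lt hx hxt)
    filter_upwards [hg' ε hε, tendsto_half_pow.eventually (gt_mem_nhds hlt)] with n h1 h2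
    have hpt : ∀ i < m n, |h' n (cell n x + (i + 1) • v) - A| ≤ 2 * ε := by
      intro i hi
      have h3 := h1 (cell n x + (i + 1) • v)
      have h4 := hA (gridPt n (cell n x + (i + 1) • v)) (by
        rw [gridPt_add, gridPt_nsmul, mem_ball_iff_norm]
        set s : ℝ := ((i + 1 : ℕ) : ℝ) / 2 ^ n with hs
        have hs0 : 0 ≤ s := by positivity
        have hst : s ≤ t := le_trans (by rw [hs]; gcongr; exact_mod_cast hi) (hmt n)
        have hmax : ‖x + s • w - x₀‖ ≤ max ‖x - x₀‖ ‖x + t • w - x₀‖ := by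
          rcases ht.eq_or_lt with ht0 | ht0
          · have : s = 0 := by linarith
            simp [this]
          · have e : x + s • w - x₀ = (1 - s / t) • (x - x₀) + (s / t) • (x + t • w - x₀) := by
              funext j
              simp only [Pi.add_apply, Pi.sub_apply, Pi.smul_apply, smul_eq_mul]
              field_simp
              ring
            have h01 : 0 ≤ 1 - s / t := sub_nonneg.2 ((div_le_one ht0).2 hst)
            have h02 : 0 ≤ s / t := by positivity
            rw [e]
            refine (norm_add_le _ _).trans ?_
            rw [norm_smul, norm_smul, Real.norm_of_nonneg h01, Real.norm_of_nonneg h02]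
            have q1 := mul_le_mul_of_nonneg_left
              (le_max_left ‖x - x₀‖ ‖x + t • w - x₀‖) h01
            have q2 := mul_le_mul_of_nonneg_left
              (le_max_right ‖x - x₀‖ ‖x + t • w - x₀‖) h02
            linarith
        have e : gridPt n (cell n x) + s • w - x₀ =
            (gridPt n (cell n x) - x) + (x + s • w - x₀) := by abel
        rw [e]
        have := norm_add_le (gridPt n (cell n x) - x) (x + s • w - x₀)
        linarith [norm_gridPt_cell_sub_le n x])
      rw [abs_lt] at h3
      rw [abs_le] at *
      constructor <;> linarith
    have hsum : h n (cell n x + m n • v) - h n (cell n x) - (m n : ℝ) / 2 ^ n * A =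
        (1 / 2 ^ n) * ∑ i ∈ Finset.range (m n), (h' n (cell n x + (i + 1) • v) - A) := by
      rw [Finset.sum_sub_distrib, hh]
      simp only [Pi.smul_apply, smul_eq_mul]
      rw [← Finset.mul_sum, sum_diff, Finset.sum_const, Finset.card_range]
      simp only [nsmul_eq_mul]
      field_simp
    rw [hsum, abs_mul, abs_of_pos (by positivity : (0 : ℝ) < 1 / 2 ^ n)]
    have := (Finset.abs_sum_le_sum_abs _ _).trans
      (Finset.sum_le_card_nsmul _ _ _ fun i hi => hpt i (Finset.mem_range.1 hi))
    rw [Finset.card_range, nsmul_eq_mul] at this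
    calc _ ≤ 1 / 2 ^ n * (m n * (2 * ε)) := mul_le_mul_of_nonneg_left this (by positivity)
      _ = _ := by ring
  intro x hx t hxt
  rcases le_total 0 t with ht | ht
  · rw [abs_of_nonneg ht]
    exact key x hx t ht hxt
  · have := key (x + t • w) hxt (-t) (by linarith) (by simpa using hx)
    rw [neg_smul, add_neg_cancel_right] at this
    rw [abs_of_nonpos ht, ← abs_neg]
    refine le_trans (le_of_eq ?_) this
    congr 1
    ring

open Classical in
/-- A function with continuous directional derivatives along a basis is differentiable. -/
theorem hasFDerivAt_of_dirIncrements (V : Module.Basis (Fin d) ℝ (Fin d → ℝ))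
    {g : (Fin d → ℝ) → ℝ} {g' : Fin d → (Fin d → ℝ) → ℝ} (hc : ∀ j, Continuous (g' j))
    (hdir : ∀ j, HasDirIncrements (V j) g (g' j)) (x : Fin d → ℝ) :
    HasFDerivAt g (∑ j, g' j x • LinearMap.toContinuousLinearMap (V.coord j)) x := by
  set φ : Fin d → ((Fin d → ℝ) →L[ℝ] ℝ) := fun j =>
    LinearMap.toContinuousLinearMap (V.coord j) with hφ
  set R : ℝ := ∑ j, ‖φ j‖ with hR
  set Q : ℝ := ∑ j, ‖φ j‖ * ‖V j‖ with hQ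
  have hR0 : 0 ≤ R := Finset.sum_nonneg fun _ _ => norm_nonneg _
  have hQ0 : 0 ≤ Q := Finset.sum_nonneg fun _ _ => by positivity
  rw [hasFDerivAt_iff_isLittleO, Asymptotics.isLittleO_iff]
  intro c hc0
  set ε : ℝ := c / (2 * (R + 1)) with hε
  have hε0 : 0 < ε := by positivity
  obtain ⟨δ, hδ, hball⟩ : ∃ δ > 0, ∀ y ∈ Metric.ball x δ, ∀ j, |g' j y - g' j x| ≤ ε := by
    have : ∀ᶠ y in 𝓝 x, ∀ j, |g' j y - g' j x| ≤ ε :=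
      eventually_all.2 fun j => (((hc j).continuousAt (x := x)).eventually
        (Metric.closedBall_mem_nhds _ hε0)).mono fun y hy => hy
    obtain ⟨δ, hδ, h⟩ := Metric.eventually_nhds_iff_ball.1 this
    exact ⟨δ, hδ, h⟩
  refine Metric.eventually_nhds_iff_ball.2 ⟨δ / (Q + 1), by positivity, fun y hy => ?_⟩
  set e := y - x with he
  rw [mem_ball_iff_norm, ← he, lt_div_iff₀ (by positivity)] at hy
  have hφe : ∀ j, |φ j e| ≤ ‖φ j‖ * ‖e‖ := fun j => (φ j).le_opNorm e
  have hp : ∀ J : Finset (Fin d), x + ∑ j ∈ J, φ j e • V j ∈ Metric.ball x δ := by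
    intro J
    rw [mem_ball_iff_norm, add_sub_cancel_left]
    have h1 : ‖∑ j ∈ J, φ j e • V j‖ ≤ ∑ j ∈ J, ‖φ j‖ * ‖V j‖ * ‖e‖ := by
      refine norm_sum_le_of_le _ fun j _ => ?_
      rw [norm_smul, mul_right_comm]
      exact mul_le_mul_of_nonneg_right (hφe j) (norm_nonneg _)
    have h2 : ∑ j ∈ J, ‖φ j‖ * ‖V j‖ * ‖e‖ ≤ Q * ‖e‖ := by
      rw [hQ, Finset.sum_mul]
      exact Finset.sum_le_sum_of_subset_of_nonneg (Finset.subset_univ J)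
        fun _ _ _ => by positivity
    have := norm_nonneg e
    nlinarith
  have hpart : ∀ J : Finset (Fin d),
      |g (x + ∑ j ∈ J, φ j e • V j) - g x - ∑ j ∈ J, φ j e * g' j x| ≤
        2 * ε * ∑ j ∈ J, |φ j e| := by
    intro J
    induction J using Finset.induction_on with
    | empty => simp
    | insert j J hj ih =>
      have h1 := hp (insert j J)
      rw [Finset.sum_insert hj, add_comm (φ j e • V j), ← add_assoc] at h1
      have h2 := hdir j x δ (g' j x) ε hε0 (fun y hy => hball y hy j) _ (hp J) _ h1
      rw [Finset.sum_insert hj, Finset.sum_insert hj, Finset.sum_insert hj,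
        add_comm (φ j e • V j), ← add_assoc]
      rw [abs_le] at *
      constructor <;> linarith
  have hsum : ∑ j, φ j e • V j = e := V.sum_repr e
  have h := hpart Finset.univ
  rw [hsum, he, add_sub_cancel, ← he] at h
  have hval : (∑ j, g' j x • φ j) e = ∑ j, φ j e * g' j x := by
    rw [sum_apply]
    exact Finset.sum_congr rfl fun j _ => mul_comm _ _
  rw [hval, Real.norm_eq_abs]
  refine h.trans ?_
  have h3 : ∑ j, |φ j e| ≤ R * ‖e‖ := by
    rw [hR, Finset.sum_mul]; exact Finset.sum_le_sum fun j _ => hφe j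
  calc 2 * ε * ∑ j, |φ j e| ≤ 2 * ε * ((R + 1) * ‖e‖) := by
        refine mul_le_mul_of_nonneg_left (h3.trans ?_) (by positivity)
        exact mul_le_mul_of_nonneg_right (by linarith) (norm_nonneg e)
    _ = c * ‖e‖ := by rw [hε]; field_simp

theorem contDiff_of_dirIncrements (V : Module.Basis (Fin d) ℝ (Fin d → ℝ))
    {G : List (Fin d) → (Fin d → ℝ) → ℝ} (hc : ∀ w, Continuous (G w))
    (hdir : ∀ j w, HasDirIncrements (V j) (G w) (G (j :: w))) (n : ℕ) (w : List (Fin d)) :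
    ContDiff ℝ n (G w) := by
  induction n generalizing w with
  | zero => exact contDiff_zero.2 (hc w)
  | succ n ih =>
    push_cast
    refine contDiff_succ_iff_hasFDerivAt.2 ⟨_, ?_, fun x =>
      hasFDerivAt_of_dirIncrements V (fun j => hc (j :: w)) (fun j => hdir j w) x⟩
    exact ContDiff.sum fun j _ => (ih (j :: w)).smul contDiff_const

theorem bounded_diffs {f : Seq d} (h : ∃ B, ∀ α, |f α| ≤ B) (w : List (Fin d → ℤ)) :
    ∃ B, ∀ α, |diffs w f α| ≤ B := by
  induction w with
  | nil => exact h
  | cons v w ih =>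
    obtain ⟨B, hB⟩ := ih
    refine ⟨B + B, fun α => ?_⟩
    rw [diffs_cons, diff]
    exact (abs_sub _ _).trans (add_le_add (hB _) (hB _))

open Classical in
theorem coe_le_nsmul {D : Multiset (Fin d → ℤ)} {w : List (Fin d → ℤ)} (hw : ∀ v ∈ w, v ∈ D)
    {k : ℕ} (hk : w.length ≤ k) : (w : Multiset (Fin d → ℤ)) ≤ k • D := by
  rw [Multiset.le_iff_count]
  intro v
  rw [Multiset.coe_count, Multiset.count_nsmul]
  by_cases hv : v ∈ w
  · exact (List.count_le_length.trans hk).trans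
      (Nat.le_mul_of_pos_right k (Multiset.count_pos.2 (hw v hv)))
  · rw [List.count_eq_zero_of_not_mem hv]; exact Nat.zero_le _

/-- The scaled differences `2^{n |w|} ∇_w f n` converge uniformly to a continuous function. -/
theorem StationaryConvergent.exists_gridLimit_diffs {a : Mask d} (ha : StationaryConvergent a)
    {D : Multiset (Fin d → ℤ)} {r : ℕ} (hr : 1 ≤ r) {f : ℕ → Seq d}
    (hf : ∀ n, f (n + 1) = avgs ((n / r) • D) (subdivOp a (f n)))
    (hb : ∃ B, ∀ α, |f 0 α| ≤ B) (w : List (Fin d → ℤ)) (hw : ∀ v ∈ w, v ∈ D) :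
    ∃ g : (Fin d → ℝ) → ℝ, Continuous g ∧
      IsGridLimit (fun n => ((2 : ℝ) ^ n) ^ w.length • diffs w (f n)) g := by
  classical
  have hbn : ∀ n, ∃ B, ∀ α, |f n α| ≤ B := by
    intro n
    induction n with
    | zero => exact hb
    | succ n ih =>
      obtain ⟨B, hB⟩ := bounded_subdivOp a ih
      exact ⟨B, by rw [hf]; exact bounded_avgs hB _⟩
  set N : ℕ := w.length * r with hN
  set S : ℝ := (D.map (‖·‖)).sum with hS
  have hS0 : 0 ≤ S := Multiset.sum_nonneg fun x hx => by
    obtain ⟨v, -, rfl⟩ := Multiset.mem_map.1 hx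
    exact norm_nonneg v
  have hE : ∀ n, ((N + n) / r) • D = (((N + n) / r) • D - w) + w := fun n =>
    (Multiset.sub_add_cancel (coe_le_nsmul hw
      ((Nat.le_div_iff_mul_le hr).2 (Nat.le_add_right N n)))).symm
  refine ha.exists_gridLimit (N := N) (E := fun n => ((N + n) / r) • D - w)
    (K := (N + 1) * S) (fun n => ?_) (fun n => ?_) ?_
  · rw [← add_assoc N n 1, hf, hE, diffs_avgs_subdivOp, ← hE, subdivOp_smul, avgs_smul, smul_smul,
      ← mul_pow]
    congr 2
    rw [pow_succ]
    ring
  · have h1 : ((((N + n) / r) • D).map (‖·‖)).sum = (((N + n) / r : ℕ) : ℝ) * S := by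
      rw [Multiset.map_nsmul, Multiset.sum_nsmul, nsmul_eq_mul]
    have h2 : (((N + n) / r : ℕ) : ℝ) ≤ (N + 1) * (n + 1) := by
      have : (N + n) / r ≤ (N + 1) * (n + 1) := (Nat.div_le_self _ _).trans (by nlinarith)
      exact_mod_cast this
    have h3 : 0 ≤ ((w : Multiset (Fin d → ℤ)).map (‖·‖)).sum := Multiset.sum_nonneg fun x hx => by
      obtain ⟨v, -, rfl⟩ := Multiset.mem_map.1 hx
      exact norm_nonneg v
    have h4 := mul_le_mul_of_nonneg_right h2 hS0
    have h5 := congrArg (fun F => (F.map (‖·‖)).sum) (hE n)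
    simp only [Multiset.map_add, Multiset.sum_add] at h5
    linarith
  · obtain ⟨B, hB⟩ := bounded_diffs (hbn N) w
    refine ⟨|((2 : ℝ) ^ N) ^ w.length| * B, fun α => ?_⟩
    rw [Pi.smul_apply, smul_eq_mul, abs_mul]
    exact mul_le_mul_of_nonneg_left (hB α) (abs_nonneg _)

theorem StationaryConvergent.exists_contDiff_gridLimit {a : Mask d} (ha : StationaryConvergent a)
    {D : Multiset (Fin d → ℤ)} (V : Module.Basis (Fin d) ℝ (Fin d → ℝ))
    (hV : ∀ j, ∃ v ∈ D, (fun i => (v i : ℝ)) = V j) {r : ℕ} (hr : 1 ≤ r) {f : ℕ → Seq d}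
    (hf : ∀ n, f (n + 1) = avgs ((n / r) • D) (subdivOp a (f n)))
    (hb : ∃ B, ∀ α, |f 0 α| ≤ B) :
    ∃ g : (Fin d → ℝ) → ℝ, ContDiff ℝ (⊤ : ℕ∞) g ∧ IsGridLimit f g := by
  choose v hvD hvV using hV
  have hlim := fun w : List (Fin d) => ha.exists_gridLimit_diffs hr hf hb (w.map v) fun u hu => by
    obtain ⟨j, -, rfl⟩ := List.mem_map.1 hu
    exact hvD j
  choose G hGc hG using hlim
  refine ⟨G [], contDiff_infty.2 fun n => contDiff_of_dirIncrements V hGc (fun j w => ?_) n [], ?_⟩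
  · rw [← hvV]
    refine IsGridLimit.hasDirIncrements (fun n => ?_) (hGc w) (hG w) (hG (j :: w))
    rw [List.map_cons, diffs_cons, List.length_cons, diff_smul, smul_smul, pow_succ']
  · simpa [diffs] using hG []

end Subdivision

open Subdivision

theorem corollary3p8 (d : ℕ) (D₀ : Multiset (Fin d → ℕ))
    (V : Module.Basis (Fin d) ℝ (Fin d → ℝ))
    (hV : ∀ j, ∃ v ∈ D₀, (fun i => (v i : ℝ)) = V j)
    (a : Subdivision.Mask d)
    (ha : ∀ z : Fin d → ℂ, (∀ i, z i ≠ 0) →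
      Subdivision.symbol a z = (2 : ℂ) ^ d * Subdivision.smoothingSymbol D₀ z)
    (hconv : Subdivision.StationaryConvergent a)
    (r : ℕ) (hr : 1 ≤ r)
    (c : ℕ → Subdivision.Mask d)
    (hc : ∀ k j : ℕ, j < r → ∀ z : Fin d → ℂ, (∀ i, z i ≠ 0) →
      Subdivision.symbol (c (k * r + j)) z
        = (2 : ℂ) ^ (-((d : ℤ) * (k : ℤ))) * Subdivision.symbol a z ^ (k + 1)) :
    Subdivision.ConvergesToCs ⊤ c := by
  set D : Multiset (Fin d → ℤ) := D₀.map fun v i => (v i : ℤ) with hD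
  have hsub : ∀ n f, subdivOp (c n) f = avgs ((n / r) • D) (subdivOp a f) := by
    intro n f
    rw [hD, ← Multiset.map_nsmul]
    refine subdivOp_eq_avgs (fun z hz => ?_) f
    have h := hc (n / r) (n % r) (Nat.mod_lt n hr) z hz
    rw [Nat.div_add_mod'] at h
    have h2 : (2 : ℂ) ^ (d * (n / r)) ≠ 0 := pow_ne_zero _ two_ne_zero
    rw [h, smoothingSymbol_nsmul, pow_succ, ← mul_assoc]
    congr 1
    rw [ha z hz, mul_pow, ← pow_mul, zpow_neg, ← Nat.cast_mul, zpow_natCast, ← mul_assoc,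
      inv_mul_cancel₀ h2, one_mul]
  have hVD : ∀ j, ∃ v ∈ D, (fun i => (v i : ℝ)) = V j := by
    intro j
    obtain ⟨v, hv, hvj⟩ := hV j
    exact ⟨_, Multiset.mem_map_of_mem _ hv, by rw [← hvj]; simp⟩
  have hlim : ∀ f₀ : Seq d, Memℓp f₀ ⊤ →
      ∃ g : (Fin d → ℝ) → ℝ, ContDiff ℝ (⊤ : ℕ∞) g ∧ IsLimitFunction c f₀ g := by
    intro f₀ hf₀
    obtain ⟨B, hB⟩ := memℓp_infty_iff.1 hf₀
    obtain ⟨g, hg, hl⟩ := hconv.exists_contDiff_gridLimit V hVD hr (f := refinedData c f₀)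
      (fun n => hsub n _) ⟨B, fun α => hB ⟨α, rfl⟩⟩
    exact ⟨g, hg, isLimitFunction_iff.2 hl⟩
  refine ⟨hlim, fun _ => 1, fun h => one_ne_zero (congrFun h 0), ?_⟩
  have h1 : Memℓp (fun _ => 1 : Seq d) ⊤ := memℓp_infty ⟨1, by rintro _ ⟨α, rfl⟩; simp⟩
  obtain ⟨g, hg, hl⟩ := hlim _ h1
  refine ⟨h1, g, ?_, hg, hl⟩
  rintro rfl
  have havg : ∀ E : Multiset (Fin d → ℤ), avgs E (fun _ => 1) = fun _ => 1 := by
    intro E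
    induction E using Multiset.induction_on with
    | empty => rfl
    | cons v E ih => rw [avgs_cons, ih]; funext α; simp [avg]
  have hconst : ∀ n, refinedData c (fun _ => 1) n = fun _ => 1 := by
    intro n
    induction n with
    | zero => rfl
    | succ n ih => rw [refinedData, ih, hsub, hconv.reproducesConst, havg]
  obtain ⟨n, hn⟩ := (isLimitFunction_iff.1 hl 1 one_pos).exists
  have := hn 0
  rw [hconst] at this
  norm_num at this
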